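/- Let $g,\nu,\ell$ be natural numbers and let $\mathbb{R}\langle x,x^*\rangle$ be the free real algebra on the $2g$ letters $x_1,\dots,x_g,x_1^*,\dots,x_g^*$, with the $\mathbb{R}$-linear involution satisfying $(x_i)^*=x_i^*$, $(x_i^*)^*=x_i$ and $(pq)^*=q^*p^*$. For a matrix $p=\sum_w A_w\otimes w\in\mathbb{R}^{\nu\times\ell}\langle x,x^*\rangle$ over this algebra let $p^*=\sum_w A_w^{T}\otimes w^*$, and for $X\in(\mathbb{R}^{n\times n})^g$ let $p(X)=\sum_w A_w\otimes w(X)\in\mathbb{R}^{\nu n\times \ell n}$ (Kronecker products), where $w(X)$ is obtained by substituting $X_i$ for $x_i$ and $X_i^{T}$ for $x_i^*$. A linear pencil is a matrix $L\in\mathbb{R}^{\nu\times\nu}\langle x,x^*\rangle$ of degree at most $1$ with $L^*=L$ (it need not be monic). A left module is a left $\mathbb{R}\langle x,x^*\rangle$-submodule $I\subseteq\mathbb{R}^{1\times\ell}\langle x,x^*\rangle$. Let $V(I)$ be the set of all pairs $(X,v)$ with $n\in\mathbb{N}$, $X\in(\mathbb{R}^{n\times n})^g$, $v\in\mathbb{R}^{\ell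 n}$ and $\iota(X)v=0$ for all $\iota\in I$. Let $\mathbb{R}^{k\times 1}I$ denote the set of $k\times\ell$ matrices over $\mathbb{R}\langle x,x^*\rangle$ all of whose rows lie in $I$, and $I^*\mathbb{R}^{1\times\ell}=(\mathbb{R}^{\ell\times 1}I)^*$. The left module $I$ is called $L$-real (respectively, strongly $L$-real) if, whenever $$\sum_i p_i^*p_i+\sum_j q_j^*Lq_j\in\mathbb{R}^{\ell\times1}I+I^*\mathbb{R}^{1\times\ell}$$ for finitely many $p_i\in\mathbb{R}^{1\times\ell}\langle x,x^*\rangle$ and $q_j\in\mathbb{R}^{\nu\times\ell}\langle x,x^*\rangle$, then each $p_i\in I$ and each $Lq_j\in\mathbb{R}^{\nu\times1}I$ (respectively, each $p_i\in I$ and each $q_j\in\mathbb{R}^{\nu\times1}I$). The $L$-real radical (respectively, strong $L$-real radical) of $I$ is the intersection of all $L$-real (respectively, strongly $L$-real) left modules containing $I$. Let $L\in\mathbb{R}^{\nu\times\nu}\langle x,x^*\rangle$ be a linear pencil, let $I\subseteq\mathbb{R}^{1\times\ell}\langle x,x^*\rangle$ be a finitely generated left module, and let $p\in\mathbb{R}^{1\times\ell}\langle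 x,x^*\rangle$. Then: 1. $p(X)v=0$ for all $(X,v)\in V(I)$ with $L(X)\succeq0$ if and only if $p$ lies in the $L$-real radical of $I$; 2. $p(X)v=0$ for all $(X,v)\in V(I)$ with $L(X)\succ0$ if and only if $p$ lies in the strong $L$-real radical of $I$. -/

import Mathlib

open scoped Matrix

namespace NCReal

/-- The letters `x₁, …, x_g, x₁*, …, x_g*`: `Sum.inl i` is `xᵢ` and `Sum.inr i` is `xᵢ*`. -/
abbrev Letter (g : ℕ) : Type := Fin g ⊕ Fin g

/-- Real noncommutative polynomials in `x₁, …, x_g, x₁*, …, x_g*`, the free `ℝ`-algebra on the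
`2g` letters. (A type synonym of its own, since Mathlib's star on a free algebra fixes the
letters instead of exchanging `xᵢ` and `xᵢ*`.) -/
def NCPoly (g : ℕ) : Type := FreeAlgebra ℝ (Letter g)

noncomputable section

instance (g : ℕ) : Ring (NCPoly g) := inferInstanceAs (Ring (FreeAlgebra ℝ (Letter g)))

instance (g : ℕ) : Algebra ℝ (NCPoly g) :=
  inferInstanceAs (Algebra ℝ (FreeAlgebra ℝ (Letter g)))

/-- A letter as a polynomial. -/
def letter {g : ℕ} (a : Letter g) : NCPoly g := FreeAlgebra.ι ℝ a

/-- The algebra homomorphism out of the free algebra given by the images of the letters. -/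
def liftHom {g : ℕ} {B : Type*} [Semiring B] [Algebra ℝ B] (f : Letter g → B) :
    NCPoly g →ₐ[ℝ] B :=
  FreeAlgebra.lift ℝ f

theorem liftHom_letter {g : ℕ} {B : Type*} [Semiring B] [Algebra ℝ B] (f : Letter g → B)
    (a : Letter g) : liftHom f (letter a) = f a :=
  FreeAlgebra.lift_ι_apply f a

theorem algHom_ext {g : ℕ} {B : Type*} [Semiring B] [Algebra ℝ B] {φ ψ : NCPoly g →ₐ[ℝ] B}
    (h : ∀ a, φ (letter a) = ψ (letter a)) : φ = ψ :=
  FreeAlgebra.hom_ext (funext h)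

/-- The involution as a homomorphism to the opposite algebra. -/
def invHom (g : ℕ) : NCPoly g →ₐ[ℝ] (NCPoly g)ᵐᵒᵖ :=
  liftHom fun a => MulOpposite.op (letter a.swap)

theorem invHom_invHom {g : ℕ} (p : NCPoly g) :
    (invHom g (invHom g p).unop).unop = p := by
  have h : ((AlgEquiv.opOp ℝ (NCPoly g)).symm.toAlgHom.comp
      ((AlgHom.op (invHom g)).comp (invHom g))) = AlgHom.id ℝ (NCPoly g) := by
    apply algHom_ext
    intro a
    simp [invHom, liftHom_letter]
  exact DFunLike.congr_fun h p

/-- The involution on `ℝ⟨x, x*⟩`: linear, anti-multiplicative, exchanging `xᵢ` and `xᵢ*`. -/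
instance (g : ℕ) : StarRing (NCPoly g) where
  star p := (invHom g p).unop
  star_involutive := invHom_invHom
  star_mul p q := by simp
  star_add p q := by simp

/-- The monomial given by a word in the letters. -/
def word {g : ℕ} (w : List (Letter g)) : NCPoly g := (w.map letter).prod

/-- The polynomials of degree at most `d`. -/
def degLE (g d : ℕ) : Submodule ℝ (NCPoly g) :=
  Submodule.span ℝ {m | ∃ w : List (Letter g), w.length ≤ d ∧ m = word w}

/-- Evaluation `p ↦ p(X)` at a tuple of real `n × n` matrices: `xᵢ ↦ Xᵢ`, `xᵢ* ↦ Xᵢᵀ`. -/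
def eval {g n : ℕ} (X : Fin g → Matrix (Fin n) (Fin n) ℝ) :
    NCPoly g →ₐ[ℝ] Matrix (Fin n) (Fin n) ℝ :=
  liftHom (Sum.elim X fun i => (X i)ᵀ)

/-- Evaluation of a `ν × ℓ` matrix of polynomials, `∑ A_w ⊗ w ↦ ∑ A_w ⊗ w(X)`
(Kronecker product), a real matrix of size `νn × ℓn`. -/
def evalMatrix {g n ν ℓ : ℕ} (X : Fin g → Matrix (Fin n) (Fin n) ℝ)
    (M : Matrix (Fin ν) (Fin ℓ) (NCPoly g)) : Matrix (Fin ν × Fin n) (Fin ℓ × Fin n) ℝ :=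
  Matrix.of fun ia jb => eval X (M ia.1 jb.1) ia.2 jb.2

/-- Row vectors of polynomials, the left `ℝ⟨x, x*⟩`-module `ℝ^{1×ℓ}⟨x, x*⟩`. -/
abbrev Row (g ℓ : ℕ) : Type := Fin ℓ → NCPoly g

/-- Evaluation of a row of polynomials, a real matrix of size `n × ℓn`. -/
def evalRow {g n ℓ : ℕ} (X : Fin g → Matrix (Fin n) (Fin n) ℝ) (p : Row g ℓ) :
    Matrix (Fin n) (Fin ℓ × Fin n) ℝ :=
  Matrix.of fun a jb => eval X (p jb.1) a jb.2

/-- `V(S)⁽ⁿ⁾`: the pairs `(X, v)` with `p(X)v = 0` for all `p ∈ S`. -/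
def zeroSet {g ℓ : ℕ} (S : Set (Row g ℓ)) (n : ℕ) :
    Set ((Fin g → Matrix (Fin n) (Fin n) ℝ) × (Fin ℓ × Fin n → ℝ)) :=
  {Xv | ∀ p ∈ S, evalRow Xv.1 p *ᵥ Xv.2 = 0}

/-- A linear pencil is a symmetric matrix polynomial of degree at most one. -/
structure IsLinearPencil {g ν : ℕ} (L : Matrix (Fin ν) (Fin ν) (NCPoly g)) : Prop where
  symm : Lᴴ = L
  deg_le : ∀ i j, L i j ∈ degLE g 1

/-- `ℝ^{k×1} I`: the `k × ℓ` matrices all of whose rows lie in `I`. -/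
def rowsIn {g ℓ : ℕ} (k : ℕ) (I : Submodule (NCPoly g) (Row g ℓ)) :
    Set (Matrix (Fin k) (Fin ℓ) (NCPoly g)) :=
  {M | ∀ i, M i ∈ I}

/-- `ℝ^{ℓ×1} I + I* ℝ^{1×ℓ}`, where `I* ℝ^{1×ℓ} = (ℝ^{ℓ×1} I)*`. -/
def symmSpan {g ℓ : ℕ} (I : Submodule (NCPoly g) (Row g ℓ)) :
    Set (Matrix (Fin ℓ) (Fin ℓ) (NCPoly g)) :=
  {M | ∃ A ∈ rowsIn ℓ I, ∃ B ∈ rowsIn ℓ I, M = A + Bᴴ}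

/-- The weighted sum of squares `∑ pᵢ* pᵢ + ∑ qⱼ* L qⱼ`; `p* p` is the matrix with entries
`(p a)* (p b)`. -/
def weightedSOS {g ν ℓ r s : ℕ} (L : Matrix (Fin ν) (Fin ν) (NCPoly g))
    (p : Fin r → Row g ℓ) (q : Fin s → Matrix (Fin ν) (Fin ℓ) (NCPoly g)) :
    Matrix (Fin ℓ) (Fin ℓ) (NCPoly g) :=
  ∑ i, Matrix.vecMulVec (star (p i)) (p i) + ∑ j, (q j)ᴴ * L * q j

/-- `I` is `L`-real. -/
def IsLReal {g ν ℓ : ℕ} (L : Matrix (Fin ν) (Fin ν) (NCPoly g))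
    (I : Submodule (NCPoly g) (Row g ℓ)) : Prop :=
  ∀ (r s : ℕ) (p : Fin r → Row g ℓ) (q : Fin s → Matrix (Fin ν) (Fin ℓ) (NCPoly g)),
    weightedSOS L p q ∈ symmSpan I → (∀ i, p i ∈ I) ∧ ∀ j, L * q j ∈ rowsIn ν I

/-- `I` is strongly `L`-real. -/
def IsStronglyLReal {g ν ℓ : ℕ} (L : Matrix (Fin ν) (Fin ν) (NCPoly g))
    (I : Submodule (NCPoly g) (Row g ℓ)) : Prop :=
  ∀ (r s : ℕ) (p : Fin r → Row g ℓ) (q : Fin s → Matrix (Fin ν) (Fin ℓ) (NCPoly g)),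
    weightedSOS L p q ∈ symmSpan I → (∀ i, p i ∈ I) ∧ ∀ j, q j ∈ rowsIn ν I

/-- The `L`-real radical of `I`: the intersection of all `L`-real left modules containing `I`. -/
def lRadical {g ν ℓ : ℕ} (L : Matrix (Fin ν) (Fin ν) (NCPoly g))
    (I : Submodule (NCPoly g) (Row g ℓ)) : Submodule (NCPoly g) (Row g ℓ) :=
  sInf {J | I ≤ J ∧ IsLReal L J}

/-- The strong `L`-real radical of `I`: the intersection of all strongly `L`-real left modules
containing `I`. -/
def strongLRadical {g ν ℓ : ℕ} (L : Matrix (Fin ν) (Fin ν) (NCPoly g))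
    (I : Submodule (NCPoly g) (Row g ℓ)) : Submodule (NCPoly g) (Row g ℓ) :=
  sInf {J | I ≤ J ∧ IsStronglyLReal L J}

end

end NCReal

/-! For a point `(X, v)`, the rows `r` with `r(X)v = 0` form a left module. It is `L`-real when
`L(X)` is positive semidefinite and strongly `L`-real when `L(X)` is positive definite: pairing a
weighted sum of squares with `v` gives a sum of nonnegative numbers, and membership in the symmetric
span makes it zero. Hence everything in a radical vanishes at the corresponding points
(`isLReal_annihilator`, `isStronglyLReal_annihilator`).

Conversely, let `J` be `L`-real with `I ≤ J` and `p ∉ J`. Let `D` bound the degrees of `p` and of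
finitely many generators of `I`. Modulo the symmetric span of `J`, the squares `c* c` and `q* L q`
with `c`, `q` of degree at most `D` generate a cone with compact base, and `L`-reality says that no
nontrivial sum of them is zero. Separating the base from the origin gives a strictly positive
functional (`exists_pos_functional`), hence a symmetric form `F` with `F(fa, b) = F(a, f*b)` that
vanishes on `J` (`IsLReal.exists_form`).

On a complement of `J` in degree at most `D`, `F` is an inner product. Compressing multiplication by
the letters to it gives `X`, and the classes of the unit rows give `v`
(`exists_gns_representation`). In degree at most `D`, `r(X)v = 0` exactly when `r ∈ J`, so `(X, v)`
lies in `V(I)` and `p(X)v ≠ 0`. As `L` has degree at most one, `L(X)` is the compression of `L`, and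
its quadratic form takes the values of `F` on `q* L q`, which are nonnegative. If `J` is strongly
`L`-real, such a value is zero only for `q` in `J`, so `L(X)` is positive definite. -/

/-! ### Convexity and linear algebra over the reals -/

/-- The convex hull of a compact set in a finite-dimensional space is compact. -/
theorem isCompact_convexHull_of_finiteDimensional {E : Type*} [NormedAddCommGroup E]
    [NormedSpace ℝ E] [FiniteDimensional ℝ E] {K : Set E} (hK : IsCompact K) :
    IsCompact (convexHull ℝ K) := by
  rcases K.eq_empty_or_nonempty with rfl | ⟨k₀, hk₀⟩
  · simp
  set m := Module.finrank ℝ E + 1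
  have himg : convexHull ℝ K = (fun wz : (Fin m → ℝ) × (Fin m → E) => ∑ i, wz.1 i • wz.2 i) ''
      (stdSimplex ℝ (Fin m) ×ˢ Set.univ.pi fun _ => K) := by
    apply Set.Subset.antisymm
    · intro x hx
      -- Carathéodory: affinely independent points suffice, so at most `m` of them. Unused slots get
      -- weight zero at `k₀`.
      obtain ⟨ι, _, z, w, hz, hind, hw, hsum, rfl⟩ := eq_pos_convex_span_of_mem_convexHull hx
      have hcard : Fintype.card ι ≤ Fintype.card (Fin m) := by
        rw [Fintype.card_fin]
        exact hind.card_le_finrank_succ.trans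
          (Nat.succ_le_succ (Submodule.finrank_le _))
      obtain ⟨f⟩ := Function.Embedding.nonempty_of_card_le hcard
      refine ⟨(Function.extend f w 0, Function.extend f z fun _ => k₀), ⟨⟨?_, ?_⟩, ?_⟩, ?_⟩
      · intro j
        by_cases hj : ∃ i, f i = j
        · obtain ⟨i, rfl⟩ := hj
          simpa [f.injective.extend_apply] using (hw i).le
        · simp [Function.extend_apply' _ _ _ hj]
      · rw [← hsum]
        refine (Fintype.sum_of_injective f f.injective _ _ (fun j hj => ?_) fun i => ?_).symm
        · exact Function.extend_apply' _ _ _ hj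
        · exact (f.injective.extend_apply _ _ _).symm
      · intro j _
        by_cases hj : ∃ i, f i = j
        · obtain ⟨i, rfl⟩ := hj
          simpa [f.injective.extend_apply] using hz ⟨i, rfl⟩
        · simpa [Function.extend_apply' _ _ _ hj] using hk₀
      · refine (Fintype.sum_of_injective f f.injective _ _ (fun j hj => ?_) fun i => ?_).symm
        · simp [Function.extend_apply' w _ j hj]
        · simp [f.injective.extend_apply]
    · rintro _ ⟨⟨w, z⟩, ⟨hw, hz⟩, rfl⟩
      exact (convex_convexHull ℝ K).sum_mem (fun i _ => hw.1 i) hw.2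
        fun i _ => subset_convexHull ℝ K (hz i trivial)
  rw [himg]
  refine ((isCompact_stdSimplex _ _).prod (isCompact_univ_pi fun _ => hK)).image ?_
  fun_prop

/-- A compact set of a finite-dimensional space whose convex hull misses the origin is strictly
positive for some functional. -/
theorem exists_pos_of_zero_notMem_convexHull {E : Type*} [NormedAddCommGroup E]
    [NormedSpace ℝ E] [FiniteDimensional ℝ E] {K : Set E} (hK : IsCompact K)
    (h0 : (0 : E) ∉ convexHull ℝ K) : ∃ f : E →ₗ[ℝ] ℝ, ∀ k ∈ K, 0 < f k := by
  obtain ⟨f, u, hu, hf⟩ := geometric_hahn_banach_point_closed (convex_convexHull ℝ K)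
    (isCompact_convexHull_of_finiteDimensional hK).isClosed h0
  rw [map_zero] at hu
  exact ⟨f, fun k hk => hu.trans (hf k (subset_convexHull ℝ K hk))⟩

/-- A quadratic map that factors through `E ⧸ N` takes, up to positive factors, its values
outside `N` in a compact set. -/
theorem exists_compact_quadratic_values {E U : Type*} [AddCommGroup E] [Module ℝ E]
    [FiniteDimensional ℝ E] [NormedAddCommGroup U] [NormedSpace ℝ U]
    (B : E →ₗ[ℝ] E →ₗ[ℝ] U) (N : Submodule ℝ E)
    (hB : ∀ e, ∀ n ∈ N, B (e + n) (e + n) = B e e) :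
    ∃ K : Set U, IsCompact K ∧ (∀ k ∈ K, ∃ e ∉ N, k = B e e) ∧
      ∀ e ∉ N, ∃ t : ℝ, 0 < t ∧ ∃ k ∈ K, B e e = t • k := by
  obtain ⟨C, hC⟩ := N.exists_isCompl
  let F := EuclideanSpace ℝ (Fin (Module.finrank ℝ C))
  let ψ : F ≃ₗ[ℝ] C := (WithLp.linearEquiv 2 ℝ _).trans (Module.finBasis ℝ C).equivFun.symm
  let B' : F →ₗ[ℝ] F →ₗ[ℝ] U :=
    B.compl₁₂ (C.subtype ∘ₗ ψ.toLinearMap) (C.subtype ∘ₗ ψ.toLinearMap)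
  have hcont : Continuous fun x : F => B' x x := by
    have h1 : Continuous fun x : F => LinearMap.toContinuousLinearMap (B' x) :=
      ((LinearMap.toContinuousLinearMap (𝕜 := ℝ) (E := F) (F' := U)).toLinearMap ∘ₗ
        B').continuous_of_finiteDimensional
    exact h1.clm_apply continuous_id
  -- The values on the unit sphere of a complement of `N`; by homogeneity of degree two, the scaling
  -- factor below is `‖x‖ ^ 2`.
  refine ⟨(fun x : F => B' x x) '' Metric.sphere 0 1, (isCompact_sphere 0 1).image hcont, ?_, ?_⟩
  · rintro _ ⟨x, hx, rfl⟩
    refine ⟨ψ x, fun hN => ?_, rfl⟩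
    have h0 : ((ψ x : C) : E) = 0 :=
      (Submodule.disjoint_def.1 hC.disjoint) _ hN (ψ x).2
    have : x = 0 := by simpa using h0
    simp [this] at hx
  · intro e he
    obtain ⟨n, hn, c, hc, rfl⟩ := Submodule.mem_sup.1
      (hC.sup_eq_top ▸ Submodule.mem_top : e ∈ N ⊔ C)
    have hc0 : c ≠ 0 := by
      rintro rfl
      exact he (by simpa using hn)
    obtain ⟨x, hx⟩ := ψ.surjective ⟨c, hc⟩
    have hx0 : x ≠ 0 := by
      rintro rfl
      apply hc0
      have := congrArg Subtype.val hx
      simpa using this.symm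
    have hnorm : 0 < ‖x‖ := norm_pos_iff.2 hx0
    refine ⟨‖x‖ ^ 2, by positivity, _, ⟨‖x‖⁻¹ • x, ?_, rfl⟩, ?_⟩
    · simp [norm_smul, hnorm.ne']
    · have hxx : B' x x = B c c := by simp [B', hx]
      rw [add_comm n c, hB c n hn, ← hxx]
      simp only [map_smul, LinearMap.smul_apply, smul_smul]
      field_simp
      simp

/-- The values of two quadratic maps on finite-dimensional spaces, no nontrivial sum of which
vanishes, are strictly positive for a common functional. -/
theorem exists_pos_functional_of_normed {E₁ E₂ U : Type*} [AddCommGroup E₁] [Module ℝ E₁]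
    [FiniteDimensional ℝ E₁] [AddCommGroup E₂] [Module ℝ E₂] [FiniteDimensional ℝ E₂]
    [NormedAddCommGroup U] [NormedSpace ℝ U] [FiniteDimensional ℝ U]
    (B₁ : E₁ →ₗ[ℝ] E₁ →ₗ[ℝ] U) (N₁ : Submodule ℝ E₁)
    (h₁ : ∀ e, ∀ n ∈ N₁, B₁ (e + n) (e + n) = B₁ e e)
    (B₂ : E₂ →ₗ[ℝ] E₂ →ₗ[ℝ] U) (N₂ : Submodule ℝ E₂)
    (h₂ : ∀ e, ∀ n ∈ N₂, B₂ (e + n) (e + n) = B₂ e e)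
    (hpos : ∀ (r : ℕ) (e : Fin r → E₁) (f : Fin r → E₂),
      ∑ i, B₁ (e i) (e i) + ∑ i, B₂ (f i) (f i) = 0 → ∀ i, e i ∈ N₁ ∧ f i ∈ N₂) :
    ∃ φ : U →ₗ[ℝ] ℝ, (∀ e ∉ N₁, 0 < φ (B₁ e e)) ∧ ∀ f ∉ N₂, 0 < φ (B₂ f f) := by
  obtain ⟨K₁, hK₁, hval₁, hray₁⟩ := exists_compact_quadratic_values B₁ N₁ h₁
  obtain ⟨K₂, hK₂, hval₂, hray₂⟩ := exists_compact_quadratic_values B₂ N₂ h₂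
  have h0 : (0 : U) ∉ convexHull ℝ (K₁ ∪ K₂) := by
    intro hmem
    obtain ⟨ι, _, w, z, hw, hsum, hz, hzero⟩ := mem_convexHull_iff_exists_fintype.1 hmem
    have hdec : ∀ i, ∃ (e : E₁) (f : E₂), w i • z i = B₁ e e + B₂ f f ∧
        (e ∈ N₁ → f ∈ N₂ → w i = 0) := by
      intro i
      -- The square root of a convex weight is absorbed into the vector, so a convex combination of
      -- values is itself a sum of values.
      have hs : √(w i) * √(w i) = w i := Real.mul_self_sqrt (hw i)
      rcases hz i with h | h
      · obtain ⟨e, he, hze⟩ := hval₁ _ h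
        refine ⟨√(w i) • e, 0, ?_, fun hmem _ => ?_⟩
        · simp [hze, smul_smul, hs]
        · by_contra hne
          exact he ((N₁.smul_mem_iff fun h => hne (by rw [← hs, h, zero_mul])).1 hmem)
      · obtain ⟨f, hf, hzf⟩ := hval₂ _ h
        refine ⟨0, √(w i) • f, ?_, fun _ hmem => ?_⟩
        · simp [hzf, smul_smul, hs]
        · by_contra hne
          exact hf ((N₂.smul_mem_iff fun h => hne (by rw [← hs, h, zero_mul])).1 hmem)
    choose e f hef hw0 using hdec
    let σ := Fintype.equivFin ι
    have := hpos _ (fun i => e (σ.symm i)) (fun i => f (σ.symm i)) (by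
      rw [← Finset.sum_add_distrib, σ.symm.sum_comp fun i => B₁ (e i) (e i) + B₂ (f i) (f i),
        ← hzero]
      exact Finset.sum_congr rfl fun i _ => (hef i).symm)
    have hall : ∀ i, w i = 0 := fun i => by
      have h := this (σ i)
      rw [σ.symm_apply_apply] at h
      exact hw0 i h.1 h.2
    simp [hall] at hsum
  obtain ⟨φ, hφ⟩ := exists_pos_of_zero_notMem_convexHull (hK₁.union hK₂) h0
  refine ⟨φ, fun e he => ?_, fun f hf => ?_⟩
  · obtain ⟨t, ht, k, hk, h⟩ := hray₁ e he
    rw [h, map_smul]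
    exact mul_pos ht (hφ k (Or.inl hk))
  · obtain ⟨t, ht, k, hk, h⟩ := hray₂ f hf
    rw [h, map_smul]
    exact mul_pos ht (hφ k (Or.inr hk))

/-- The same for quadratic maps into an arbitrary real vector space. -/
theorem exists_pos_functional {E₁ E₂ Q : Type*} [AddCommGroup E₁] [Module ℝ E₁]
    [FiniteDimensional ℝ E₁] [AddCommGroup E₂] [Module ℝ E₂] [FiniteDimensional ℝ E₂]
    [AddCommGroup Q] [Module ℝ Q]
    (B₁ : E₁ →ₗ[ℝ] E₁ →ₗ[ℝ] Q) (N₁ : Submodule ℝ E₁)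
    (h₁ : ∀ e, ∀ n ∈ N₁, B₁ (e + n) (e + n) = B₁ e e)
    (B₂ : E₂ →ₗ[ℝ] E₂ →ₗ[ℝ] Q) (N₂ : Submodule ℝ E₂)
    (h₂ : ∀ e, ∀ n ∈ N₂, B₂ (e + n) (e + n) = B₂ e e)
    (hpos : ∀ (r : ℕ) (e : Fin r → E₁) (f : Fin r → E₂),
      ∑ i, B₁ (e i) (e i) + ∑ i, B₂ (f i) (f i) = 0 → ∀ i, e i ∈ N₁ ∧ f i ∈ N₂) :
    ∃ φ : Q →ₗ[ℝ] ℝ, (∀ e ∉ N₁, 0 < φ (B₁ e e)) ∧ ∀ f ∉ N₂, 0 < φ (B₂ f f) := by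
  -- All values lie in this finite-dimensional subspace. Projecting onto it and taking coordinates
  -- supplies a norm.
  let T : Submodule ℝ Q :=
    LinearMap.range (TensorProduct.lift B₁) ⊔ LinearMap.range (TensorProduct.lift B₂)
  obtain ⟨π, hπ⟩ := LinearMap.exists_extend (LinearMap.id : T →ₗ[ℝ] T)
  let ψ := (Module.finBasis ℝ T).equivFun
  have hker : ∀ q ∈ T, ψ (π q) = 0 → q = 0 := by
    intro q hq h
    have h' : π q = ⟨q, hq⟩ := LinearMap.congr_fun hπ ⟨q, hq⟩
    rw [h'] at h
    simpa using h
  have hmem₁ : ∀ a b, B₁ a b ∈ T := fun a b =>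
    Submodule.mem_sup_left ⟨a ⊗ₜ b, TensorProduct.lift.tmul _ _⟩
  have hmem₂ : ∀ a b, B₂ a b ∈ T := fun a b =>
    Submodule.mem_sup_right ⟨a ⊗ₜ b, TensorProduct.lift.tmul _ _⟩
  obtain ⟨φ, hφ₁, hφ₂⟩ := exists_pos_functional_of_normed
    (B₁.compr₂ (ψ.toLinearMap ∘ₗ π)) N₁ (fun e n hn => by
      simp only [LinearMap.compr₂_apply, h₁ e n hn])
    (B₂.compr₂ (ψ.toLinearMap ∘ₗ π)) N₂ (fun e n hn => by
      simp only [LinearMap.compr₂_apply, h₂ e n hn])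
    (fun r e f h => by
      refine hpos r e f (hker _ ?_ ?_)
      · exact T.add_mem (T.sum_mem fun i _ => hmem₁ _ _) (T.sum_mem fun i _ => hmem₂ _ _)
      · simpa using h)
  exact ⟨φ ∘ₗ ψ.toLinearMap ∘ₗ π, hφ₁, hφ₂⟩

/-- A finite-dimensional real space with a positive definite form has an orthonormal basis. -/
theorem exists_orthonormal_basis_of_form {V : Type*} [AddCommGroup V] [Module ℝ V]
    [FiniteDimensional ℝ V] (F : V →ₗ[ℝ] V →ₗ[ℝ] ℝ) (hsymm : ∀ a b, F a b = F b a)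
    (hpos : ∀ a, a ≠ 0 → 0 < F a a) :
    ∃ (n : ℕ) (b : Module.Basis (Fin n) ℝ V), ∀ i j, F (b i) (b j) = if i = j then 1 else 0 := by
  let core : InnerProductSpace.Core ℝ V :=
    { inner := fun a b => F a b
      conj_inner_symm := fun a b => hsymm b a
      re_inner_nonneg := fun a => by
        by_cases h : a = 0
        · simp [h]
        · exact (hpos a h).le
      add_left := fun a b c => by simp
      smul_left := fun a b r => by simp
      definite := fun a h => by
        by_contra hne
        exact (hpos a hne).ne' h }
  let _ : NormedAddCommGroup V := core.toNormedAddCommGroup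
  let _ : InnerProductSpace ℝ V := InnerProductSpace.ofCore core.toCore
  let b := stdOrthonormalBasis ℝ V
  exact ⟨_, b.toBasis, fun i j => by
    rw [b.coe_toBasis]
    exact orthonormal_iff_ite.1 b.orthonormal i j⟩

/-! ### Words, degrees and the involution -/

namespace NCReal

variable {g ν ℓ n D : ℕ}

theorem star_eq_unop_invHom (p : NCPoly g) : star p = (invHom g p).unop := rfl

instance : StarModule ℝ (NCPoly g) where
  star_smul r p := by simp [star_eq_unop_invHom]

theorem star_letter (a : Letter g) : star (letter a) = letter a.swap := by
  simp [star_eq_unop_invHom, invHom, liftHom_letter]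

theorem word_nil : word ([] : List (Letter g)) = 1 := by simp [word]

theorem word_cons (a : Letter g) (w : List (Letter g)) : word (a :: w) = letter a * word w := by
  simp [word]

theorem word_append (u w : List (Letter g)) : word (u ++ w) = word u * word w := by
  simp [word]

instance : FiniteDimensional ℝ (degLE g D) := by
  apply FiniteDimensional.span_of_finite
  refine ((List.finite_length_le (Letter g) D).image word).subset ?_
  rintro _ ⟨w, hw, rfl⟩
  exact ⟨w, hw, rfl⟩

theorem word_mem_degLE {w : List (Letter g)} (h : w.length ≤ D) : word w ∈ degLE g D :=
  Submodule.subset_span ⟨w, h, rfl⟩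

theorem one_mem_degLE : (1 : NCPoly g) ∈ degLE g D :=
  word_nil (g := g) ▸ word_mem_degLE (Nat.zero_le D)

theorem degLE_mono {D E : ℕ} (h : D ≤ E) : degLE g D ≤ degLE g E := by
  apply Submodule.span_mono
  rintro _ ⟨w, hw, rfl⟩
  exact ⟨w, hw.trans h, rfl⟩

theorem mul_mem_degLE {D E : ℕ} {p q : NCPoly g} (hp : p ∈ degLE g D) (hq : q ∈ degLE g E) :
    p * q ∈ degLE g (D + E) := by
  have h : degLE g D * degLE g E ≤ degLE g (D + E) := by
    rw [degLE, degLE, Submodule.span_mul_span, Submodule.span_le]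
    rintro _ ⟨_, ⟨u, hu, rfl⟩, _, ⟨w, hw, rfl⟩, rfl⟩
    simp only [← word_append]
    apply word_mem_degLE
    simpa using Nat.add_le_add hu hw
  exact h (Submodule.mul_mem_mul hp hq)

/-- The polynomials of bounded degree form a subalgebra containing the letters. By the universal
property the identity factors through it. -/
theorem exists_mem_degLE (p : NCPoly g) : ∃ D, p ∈ degLE g D := by
  let A : Subalgebra ℝ (NCPoly g) :=
    { carrier := {p | ∃ D, p ∈ degLE g D}
      mul_mem' := by
        rintro p q ⟨D, hp⟩ ⟨E, hq⟩
        exact ⟨D + E, mul_mem_degLE hp hq⟩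
      add_mem' := by
        rintro p q ⟨D, hp⟩ ⟨E, hq⟩
        exact ⟨max D E, Submodule.add_mem _ (degLE_mono (le_max_left D E) hp)
          (degLE_mono (le_max_right D E) hq)⟩
      algebraMap_mem' := fun r => ⟨0, by
        rw [Algebra.algebraMap_eq_smul_one]
        exact Submodule.smul_mem _ _ one_mem_degLE⟩ }
  have hl : ∀ a : Letter g, letter a ∈ A := fun a => ⟨1, by
    simpa [word] using word_mem_degLE (w := [a]) le_rfl⟩
  have hid : A.val.comp (liftHom fun a => (⟨letter a, hl a⟩ : A)) = AlgHom.id ℝ (NCPoly g) :=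
    algHom_ext fun a => by simp [liftHom_letter]
  have := DFunLike.congr_fun hid p
  rw [AlgHom.id_apply] at this
  rw [← this]
  exact (liftHom (fun a => (⟨letter a, hl a⟩ : A)) p).2

/-- The rows of polynomials of degree at most `D`. -/
def rowDegLE (g ℓ D : ℕ) : Submodule ℝ (Row g ℓ) :=
  Submodule.pi Set.univ fun _ => degLE g D

theorem mem_rowDegLE {r : Row g ℓ} : r ∈ rowDegLE g ℓ D ↔ ∀ j, r j ∈ degLE g D := by
  simp [rowDegLE]

instance : FiniteDimensional ℝ (rowDegLE g ℓ D) :=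
  Module.Finite.of_injective
    (LinearMap.pi fun j => ((LinearMap.proj j).domRestrict (rowDegLE g ℓ D)).codRestrict
      (degLE g D) fun r => mem_rowDegLE.1 r.2 j : rowDegLE g ℓ D →ₗ[ℝ] Fin ℓ → degLE g D)
    fun _ _ h => Subtype.ext <| funext fun j => congrArg Subtype.val (congrFun h j)

theorem rowDegLE_mono {D E : ℕ} (h : D ≤ E) : rowDegLE g ℓ D ≤ rowDegLE g ℓ E :=
  fun _ hr => mem_rowDegLE.2 fun j => degLE_mono h (mem_rowDegLE.1 hr j)

theorem exists_mem_rowDegLE (r : Row g ℓ) : ∃ D, r ∈ rowDegLE g ℓ D := by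
  choose D hD using fun j => exists_mem_degLE (r j)
  exact ⟨Finset.univ.sup D, mem_rowDegLE.2 fun j =>
    degLE_mono (Finset.le_sup (Finset.mem_univ j)) (hD j)⟩

/-! ### Evaluation -/

variable (X : Fin g → Matrix (Fin n) (Fin n) ℝ)

theorem eval_letter (a : Letter g) :
    eval X (letter a) = Sum.elim X (fun i => (X i)ᵀ) a := liftHom_letter _ a

/-- Transposing after evaluating the involution is again an algebra homomorphism, and it agrees with
evaluation on the letters. -/
theorem eval_star (p : NCPoly g) : eval X (star p) = (eval X p)ᵀ := by
  have h : ((Matrix.transposeAlgEquiv (Fin n) ℝ ℝ).symm.toAlgHom.comp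
      ((AlgHom.op (eval X)).comp (invHom g))) = eval X := by
    apply algHom_ext
    rintro (i | i) <;> simp [invHom, liftHom_letter, eval_letter]
  have := DFunLike.congr_fun h p
  rw [← this]
  simp [star_eq_unop_invHom]

/-- The vector `r(X)v`. -/
theorem evalRow_mulVec (r : Row g ℓ) (v : Fin ℓ × Fin n → ℝ) :
    evalRow X r *ᵥ v = ∑ j, eval X (r j) *ᵥ fun k => v (j, k) := by
  ext a
  simp [evalRow, Matrix.mulVec, dotProduct, Fintype.sum_prod_type, Finset.sum_apply]

theorem evalRow_add_mulVec (r s : Row g ℓ) (v : Fin ℓ × Fin n → ℝ) :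
    evalRow X (r + s) *ᵥ v = evalRow X r *ᵥ v + evalRow X s *ᵥ v := by
  simp [evalRow_mulVec, Matrix.add_mulVec, Finset.sum_add_distrib]

theorem evalRow_smul_mulVec (f : NCPoly g) (r : Row g ℓ) (v : Fin ℓ × Fin n → ℝ) :
    evalRow X (f • r) *ᵥ v = eval X f *ᵥ (evalRow X r *ᵥ v) := by
  simp [evalRow_mulVec, Matrix.mulVec_sum, Matrix.mulVec_mulVec]

/-- The left module of all rows `r` with `r(X)v = 0`. -/
def annihilator (v : Fin ℓ × Fin n → ℝ) : Submodule (NCPoly g) (Row g ℓ) where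
  carrier := {r | evalRow X r *ᵥ v = 0}
  zero_mem' := by simp [evalRow_mulVec]
  add_mem' {r s} hr hs := by
    rw [Set.mem_ofPred_eq] at *
    rw [evalRow_add_mulVec, hr, hs, add_zero]
  smul_mem' f r hr := by
    rw [Set.mem_ofPred_eq] at *
    rw [evalRow_smul_mulVec, hr, Matrix.mulVec_zero]

theorem isHermitian_evalMatrix {L : Matrix (Fin ν) (Fin ν) (NCPoly g)} (hL : Lᴴ = L) :
    (evalMatrix X L).IsHermitian := by
  ext ⟨i, a⟩ ⟨j, b⟩
  have h : star (L j i) = L i j := congrFun (congrFun hL i) j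
  simp [evalMatrix, ← h, eval_star]

theorem evalMatrix_mulVec (M : Matrix (Fin ν) (Fin ℓ) (NCPoly g)) (h : Fin ℓ × Fin n → ℝ)
    (i : Fin ν) (a : Fin n) :
    (evalMatrix X M *ᵥ h) (i, a) = ∑ j, (eval X (M i j) *ᵥ fun k => h (j, k)) a := by
  simp [evalMatrix, Matrix.mulVec, dotProduct, Fintype.sum_prod_type]

theorem evalMatrix_mul_mulVec {μ : ℕ} (M : Matrix (Fin μ) (Fin ν) (NCPoly g))
    (q : Matrix (Fin ν) (Fin ℓ) (NCPoly g)) (v : Fin ℓ × Fin n → ℝ) :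
    evalMatrix X (M * q) *ᵥ v = evalMatrix X M *ᵥ (evalMatrix X q *ᵥ v) := by
  rw [Matrix.mulVec_mulVec]
  congr 1
  ext ⟨i, a⟩ ⟨j, b⟩
  simp [evalMatrix, Matrix.mul_apply, Matrix.sum_apply, Fintype.sum_prod_type]

theorem evalMatrix_conjTranspose (M : Matrix (Fin ν) (Fin ℓ) (NCPoly g)) :
    evalMatrix X Mᴴ = (evalMatrix X M)ᵀ := by
  ext ⟨i, a⟩ ⟨j, b⟩
  simp [evalMatrix, eval_star]

theorem evalMatrix_add (M N : Matrix (Fin ν) (Fin ℓ) (NCPoly g)) :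
    evalMatrix X (M + N) = evalMatrix X M + evalMatrix X N := by
  ext ⟨i, a⟩ ⟨j, b⟩
  simp [evalMatrix]

theorem evalMatrix_sum {ι : Type*} (s : Finset ι) (M : ι → Matrix (Fin ν) (Fin ℓ) (NCPoly g)) :
    evalMatrix X (∑ i ∈ s, M i) = ∑ i ∈ s, evalMatrix X (M i) := by
  ext ⟨i, a⟩ ⟨j, b⟩
  simp [evalMatrix, Matrix.sum_apply]

theorem evalMatrix_vecMulVec_star (r : Row g ℓ) :
    evalMatrix X (Matrix.vecMulVec (star r) r) = (evalRow X r)ᵀ * evalRow X r := by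
  ext ⟨i, a⟩ ⟨j, b⟩
  simp [evalMatrix, evalRow, Matrix.vecMulVec_apply, eval_star, Matrix.mul_apply]

theorem evalMatrix_mulVec_eq_zero_iff (M : Matrix (Fin ν) (Fin ℓ) (NCPoly g))
    (v : Fin ℓ × Fin n → ℝ) :
    evalMatrix X M *ᵥ v = 0 ↔ M ∈ rowsIn ν (annihilator X v) := by
  have h : ∀ i a, (evalMatrix X M *ᵥ v) (i, a) = (evalRow X (M i) *ᵥ v) a := fun i a => by
    simp [evalMatrix_mulVec, evalRow_mulVec]
  constructor
  · intro h0 i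
    ext a
    rw [← h, h0]
    rfl
  · intro hM
    ext ⟨i, a⟩
    rw [h, (hM i : evalRow X (M i) *ᵥ v = 0)]
    rfl

theorem dotProduct_transpose_mul_mulVec {m k : Type*} [Fintype m] [Fintype k]
    (A B : Matrix m k ℝ) (v : k → ℝ) : v ⬝ᵥ (Aᵀ * B) *ᵥ v = (A *ᵥ v) ⬝ᵥ (B *ᵥ v) := by
  rw [← Matrix.mulVec_mulVec, Matrix.dotProduct_mulVec, Matrix.vecMul_transpose]

/-! ### Real modules from points -/

/-- At a point where `L(X)` is positive semidefinite, a weighted sum of squares in the symmetric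
span of the annihilator has all its terms vanishing. -/
theorem vanishing_of_weightedSOS_mem {L : Matrix (Fin ν) (Fin ν) (NCPoly g)}
    (hX : (evalMatrix X L).PosSemidef) (v : Fin ℓ × Fin n → ℝ) {r s : ℕ} (p : Fin r → Row g ℓ)
    (q : Fin s → Matrix (Fin ν) (Fin ℓ) (NCPoly g))
    (h : weightedSOS L p q ∈ symmSpan (annihilator X v)) :
    (∀ i, p i ∈ annihilator X v) ∧
      ∀ j, (evalMatrix X (q j) *ᵥ v) ⬝ᵥ evalMatrix X L *ᵥ (evalMatrix X (q j) *ᵥ v) = 0 := by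
  obtain ⟨A, hA, B, hB, hAB⟩ := h
  have h0 : v ⬝ᵥ evalMatrix X (weightedSOS L p q) *ᵥ v = 0 := by
    rw [hAB, evalMatrix_add, Matrix.add_mulVec, evalMatrix_conjTranspose, dotProduct_add,
      (evalMatrix_mulVec_eq_zero_iff X A v).2 hA, dotProduct_zero, zero_add,
      Matrix.dotProduct_mulVec, Matrix.vecMul_transpose,
      (evalMatrix_mulVec_eq_zero_iff X B v).2 hB, zero_dotProduct]
  have h1 : v ⬝ᵥ evalMatrix X (weightedSOS L p q) *ᵥ v =
      ∑ i, (evalRow X (p i) *ᵥ v) ⬝ᵥ (evalRow X (p i) *ᵥ v) +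
      ∑ j, (evalMatrix X (q j) *ᵥ v) ⬝ᵥ evalMatrix X L *ᵥ (evalMatrix X (q j) *ᵥ v) := by
    rw [weightedSOS, evalMatrix_add, evalMatrix_sum, evalMatrix_sum, Matrix.add_mulVec,
      Matrix.sum_mulVec, Matrix.sum_mulVec, dotProduct_add, dotProduct_sum, dotProduct_sum]
    congr 1
    · refine Finset.sum_congr rfl fun i _ => ?_
      rw [evalMatrix_vecMulVec_star, dotProduct_transpose_mul_mulVec]
    · refine Finset.sum_congr rfl fun j _ => ?_
      rw [evalMatrix_mul_mulVec, evalMatrix_mul_mulVec, evalMatrix_conjTranspose,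
        Matrix.dotProduct_mulVec, Matrix.vecMul_transpose]
  have hp : ∀ i ∈ Finset.univ, 0 ≤ (evalRow X (p i) *ᵥ v) ⬝ᵥ (evalRow X (p i) *ᵥ v) :=
    fun i _ => Finset.sum_nonneg fun _ _ => mul_self_nonneg _
  have hq : ∀ j ∈ Finset.univ,
      0 ≤ (evalMatrix X (q j) *ᵥ v) ⬝ᵥ evalMatrix X L *ᵥ (evalMatrix X (q j) *ᵥ v) :=
    fun j _ => by simpa using hX.dotProduct_mulVec_nonneg (evalMatrix X (q j) *ᵥ v)
  rw [h0] at h1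
  obtain ⟨hp0, hq0⟩ := (add_eq_zero_iff_of_nonneg (Finset.sum_nonneg hp)
    (Finset.sum_nonneg hq)).1 h1.symm
  rw [Finset.sum_eq_zero_iff_of_nonneg hp] at hp0
  rw [Finset.sum_eq_zero_iff_of_nonneg hq] at hq0
  exact ⟨fun i => dotProduct_self_eq_zero.1 (hp0 i (Finset.mem_univ i)),
    fun j => hq0 j (Finset.mem_univ j)⟩

/-- A positive semidefinite matrix kills each vector on which its quadratic form vanishes; here the
vector is `q(X)v`. -/
theorem isLReal_annihilator {L : Matrix (Fin ν) (Fin ν) (NCPoly g)}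
    (hX : (evalMatrix X L).PosSemidef) (v : Fin ℓ × Fin n → ℝ) :
    IsLReal L (annihilator X v) := by
  intro r s p q h
  obtain ⟨hp, hq⟩ := vanishing_of_weightedSOS_mem X hX v p q h
  refine ⟨hp, fun j => ?_⟩
  rw [← evalMatrix_mulVec_eq_zero_iff, evalMatrix_mul_mulVec, ← hX.dotProduct_mulVec_zero_iff]
  simpa using hq j

theorem isStronglyLReal_annihilator {L : Matrix (Fin ν) (Fin ν) (NCPoly g)}
    (hX : (evalMatrix X L).PosDef) (v : Fin ℓ × Fin n → ℝ) :
    IsStronglyLReal L (annihilator X v) := by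
  intro r s p q h
  obtain ⟨hp, hq⟩ := vanishing_of_weightedSOS_mem X hX.posSemidef v p q h
  refine ⟨hp, fun j => ?_⟩
  rw [← evalMatrix_mulVec_eq_zero_iff]
  by_contra hne
  have := hX.dotProduct_mulVec_pos hne
  rw [star_trivial, hq j] at this
  exact lt_irrefl _ this

theorem matrix_mul_row {μ : ℕ} (N : Matrix (Fin μ) (Fin ν) (NCPoly g))
    (M : Matrix (Fin ν) (Fin ℓ) (NCPoly g)) (i : Fin μ) : (N * M) i = ∑ j, N i j • M j := by
  ext b
  simp [Matrix.mul_apply]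

/-! ### Matrices with rows in a module and the symmetric span -/

section RowsIn

variable {J : Submodule (NCPoly g) (Row g ℓ)}

theorem add_mem_rowsIn {M N : Matrix (Fin ν) (Fin ℓ) (NCPoly g)} (hM : M ∈ rowsIn ν J)
    (hN : N ∈ rowsIn ν J) : M + N ∈ rowsIn ν J :=
  fun i => J.add_mem (hM i) (hN i)

theorem smul_mem_rowsIn (r : ℝ) {M : Matrix (Fin ν) (Fin ℓ) (NCPoly g)} (hM : M ∈ rowsIn ν J) :
    r • M ∈ rowsIn ν J :=
  fun i => (J.restrictScalars ℝ).smul_mem r (hM i)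

theorem mul_mem_rowsIn {μ : ℕ} (N : Matrix (Fin μ) (Fin ν) (NCPoly g))
    {M : Matrix (Fin ν) (Fin ℓ) (NCPoly g)} (hM : M ∈ rowsIn ν J) : N * M ∈ rowsIn μ J := by
  intro i
  rw [matrix_mul_row]
  exact J.sum_mem fun j _ => J.smul_mem _ (hM j)

theorem vecMulVec_mem_rowsIn (c : Fin ν → NCPoly g) {r : Row g ℓ} (hr : r ∈ J) :
    Matrix.vecMulVec c r ∈ rowsIn ν J :=
  fun i => J.smul_mem (c i) hr

variable (J) in
/-- `symmSpan J` as a real subspace. -/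
def symmSubmodule : Submodule ℝ (Matrix (Fin ℓ) (Fin ℓ) (NCPoly g)) where
  carrier := symmSpan J
  zero_mem' := ⟨0, fun _ => J.zero_mem, 0, fun _ => J.zero_mem, by simp⟩
  add_mem' := by
    rintro _ _ ⟨A, hA, B, hB, rfl⟩ ⟨A', hA', B', hB', rfl⟩
    exact ⟨A + A', add_mem_rowsIn hA hA', B + B', add_mem_rowsIn hB hB', by
      rw [Matrix.conjTranspose_add]; abel⟩
  smul_mem' := by
    rintro r _ ⟨A, hA, B, hB, rfl⟩
    exact ⟨r • A, smul_mem_rowsIn r hA, r • B, smul_mem_rowsIn r hB, by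
      rw [Matrix.conjTranspose_smul, star_trivial, smul_add]⟩

theorem rowsIn_subset_symmSubmodule {A : Matrix (Fin ℓ) (Fin ℓ) (NCPoly g)}
    (hA : A ∈ rowsIn ℓ J) : A ∈ symmSubmodule J :=
  ⟨A, hA, 0, fun _ => J.zero_mem, by simp⟩

theorem conjTranspose_mem_symmSubmodule {A : Matrix (Fin ℓ) (Fin ℓ) (NCPoly g)}
    (hA : A ∈ rowsIn ℓ J) : Aᴴ ∈ symmSubmodule J :=
  ⟨0, fun _ => J.zero_mem, A, hA, by simp⟩

end RowsIn

/-! ### Hermitian squares and positive forms -/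

/-- The hermitian square `(a, b) ↦ a* b` of rows, as a real bilinear map. -/
def rowSquare (g ℓ : ℕ) : Row g ℓ →ₗ[ℝ] Row g ℓ →ₗ[ℝ] Matrix (Fin ℓ) (Fin ℓ) (NCPoly g) :=
  LinearMap.mk₂ ℝ (fun a b => Matrix.vecMulVec (star a) b)
    (fun a a' b => by rw [star_add, Matrix.add_vecMulVec])
    (fun r a b => by rw [star_smul, star_trivial, Matrix.smul_vecMulVec])
    (fun a b b' => by rw [Matrix.vecMulVec_add])
    (fun r a b => by rw [Matrix.vecMulVec_smul])

theorem rowSquare_apply (a b : Row g ℓ) : rowSquare g ℓ a b = Matrix.vecMulVec (star a) b := rfl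

/-- The map `(q, q') ↦ q* L q'`, as a real bilinear map. -/
def pencilSquare (ℓ : ℕ) (L : Matrix (Fin ν) (Fin ν) (NCPoly g)) :
    Matrix (Fin ν) (Fin ℓ) (NCPoly g) →ₗ[ℝ] Matrix (Fin ν) (Fin ℓ) (NCPoly g) →ₗ[ℝ]
      Matrix (Fin ℓ) (Fin ℓ) (NCPoly g) :=
  LinearMap.mk₂ ℝ (fun q q' => qᴴ * L * q')
    (fun a a' b => by rw [Matrix.conjTranspose_add, Matrix.add_mul, Matrix.add_mul])
    (fun r a b => by
      rw [Matrix.conjTranspose_smul, star_trivial, Matrix.smul_mul, Matrix.smul_mul])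
    (fun a b b' => by rw [Matrix.mul_add])
    (fun r a b => by rw [Matrix.mul_smul])

theorem pencilSquare_apply (L : Matrix (Fin ν) (Fin ν) (NCPoly g))
    (q q' : Matrix (Fin ν) (Fin ℓ) (NCPoly g)) : pencilSquare ℓ L q q' = qᴴ * L * q' := rfl

/-- Lets a form defined through `rowSquare` alone also evaluate the weighted squares. -/
theorem pencilSquare_eq_sum (L : Matrix (Fin ν) (Fin ν) (NCPoly g))
    (q q' : Matrix (Fin ν) (Fin ℓ) (NCPoly g)) :
    pencilSquare ℓ L q q' = ∑ i, ∑ j, rowSquare g ℓ (q i) (L i j • q' j) := by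
  ext a b
  simp [pencilSquare_apply, rowSquare_apply, Matrix.mul_apply, Matrix.sum_apply,
    Matrix.vecMulVec_apply, Finset.sum_mul, mul_assoc]
  rw [Finset.sum_comm]

theorem rowSquare_conjTranspose (a b : Row g ℓ) : (rowSquare g ℓ a b)ᴴ = rowSquare g ℓ b a := by
  ext i j
  simp [rowSquare_apply, Matrix.vecMulVec_apply]

/-- Source of the adjointness of multiplication by `f` and by `star f` for the form `F`. -/
theorem rowSquare_smul_left (f : NCPoly g) (a b : Row g ℓ) :
    rowSquare g ℓ (f • a) b = rowSquare g ℓ a (star f • b) := by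
  ext i j
  simp [rowSquare_apply, Matrix.vecMulVec_apply, mul_assoc]

/-- An `L`-real left module has a symmetric functional vanishing on it that is strictly positive
on all squares and weighted squares of bounded degree, apart from those in the module. -/
theorem IsLReal.exists_form {L : Matrix (Fin ν) (Fin ν) (NCPoly g)} (hL : Lᴴ = L)
    {J : Submodule (NCPoly g) (Row g ℓ)} (hJ : IsLReal L J) (D : ℕ) :
    ∃ F : Row g ℓ →ₗ[ℝ] Row g ℓ →ₗ[ℝ] ℝ, (∀ a b, F a b = F b a) ∧
      (∀ (f : NCPoly g) a b, F (f • a) b = F a (star f • b)) ∧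
      (∀ a, ∀ b ∈ J, F a b = 0) ∧
      (∀ c ∈ rowDegLE g ℓ D, c ∉ J → 0 < F c c) ∧
      ∀ q : Matrix (Fin ν) (Fin ℓ) (NCPoly g), (∀ i, q i ∈ rowDegLE g ℓ D) →
        0 ≤ ∑ i, ∑ j, F (q i) (L i j • q j) ∧
        (∑ i, ∑ j, F (q i) (L i j • q j) = 0 → L * q ∈ rowsIn ν J) := by
  let S := symmSubmodule J
  let E₁ := rowDegLE g ℓ D
  let τ : (Fin ν → E₁) →ₗ[ℝ] Matrix (Fin ν) (Fin ℓ) (NCPoly g) :=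
    LinearMap.pi fun i => E₁.subtype ∘ₗ LinearMap.proj i
  let N₁ : Submodule ℝ E₁ := (J.restrictScalars ℝ).comap E₁.subtype
  -- The condition is on `L * q` rather than `q`, since that is all `L`-reality controls. It still
  -- makes `q* L q'` vanish modulo `S` on either side, as `L` is symmetric.
  let N₂ : Submodule ℝ (Fin ν → E₁) :=
    { carrier := {q | L * τ q ∈ rowsIn ν J}
      zero_mem' := by
        rw [Set.mem_ofPred_eq, map_zero, Matrix.mul_zero]
        exact fun _ => J.zero_mem
      add_mem' := fun {a b} ha hb => by
        rw [Set.mem_ofPred_eq, map_add, Matrix.mul_add]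
        exact add_mem_rowsIn ha hb
      smul_mem' := fun r a ha => by
        rw [Set.mem_ofPred_eq, map_smul, Matrix.mul_smul]
        exact smul_mem_rowsIn r ha }
  let B₁ : E₁ →ₗ[ℝ] E₁ →ₗ[ℝ] (_ ⧸ S) :=
    ((rowSquare g ℓ).compl₁₂ E₁.subtype E₁.subtype).compr₂ S.mkQ
  let B₂ : (Fin ν → E₁) →ₗ[ℝ] (Fin ν → E₁) →ₗ[ℝ] (_ ⧸ S) :=
    ((pencilSquare ℓ L).compl₁₂ τ τ).compr₂ S.mkQ
  have hB₁ : ∀ a b, B₁ a b = S.mkQ (rowSquare g ℓ a b) := fun _ _ => rfl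
  have hB₂ : ∀ a b, B₂ a b = S.mkQ (pencilSquare ℓ L (τ a) (τ b)) := fun _ _ => rfl
  obtain ⟨φ, hφ₁, hφ₂⟩ := exists_pos_functional B₁ N₁ (fun e m hm => by
      have hm' : (m : Row g ℓ) ∈ J := hm
      have h1 : ∀ c : E₁, B₁ c m = 0 := fun c => by
        rw [hB₁, Submodule.mkQ_apply, Submodule.Quotient.mk_eq_zero]
        exact rowsIn_subset_symmSubmodule (vecMulVec_mem_rowsIn _ hm')
      have h2 : B₁ m e = 0 := by
        rw [hB₁, Submodule.mkQ_apply, Submodule.Quotient.mk_eq_zero, ← rowSquare_conjTranspose]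
        exact conjTranspose_mem_symmSubmodule (vecMulVec_mem_rowsIn _ hm')
      simp [h1, h2]) B₂ N₂ (fun e m hm => by
      have hm' : L * τ m ∈ rowsIn ν J := hm
      have h1 : ∀ c, B₂ c m = 0 := fun c => by
        rw [hB₂, Submodule.mkQ_apply, Submodule.Quotient.mk_eq_zero, pencilSquare_apply,
          Matrix.mul_assoc]
        exact rowsIn_subset_symmSubmodule (mul_mem_rowsIn _ hm')
      have h2 : B₂ m e = 0 := by
        have h : (τ m)ᴴ * L * τ e = ((τ e)ᴴ * (L * τ m))ᴴ := by
          rw [Matrix.conjTranspose_mul, Matrix.conjTranspose_mul,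
            Matrix.conjTranspose_conjTranspose, hL]
        rw [hB₂, Submodule.mkQ_apply, Submodule.Quotient.mk_eq_zero, pencilSquare_apply, h]
        exact conjTranspose_mem_symmSubmodule (mul_mem_rowsIn _ hm')
      simp [h1, h2]) (fun r e f h => by
      have hmem : weightedSOS L (fun i => (e i : Row g ℓ)) (fun i => τ (f i)) ∈ S := by
        rw [← Submodule.Quotient.mk_eq_zero, ← Submodule.mkQ_apply, ← h, weightedSOS, map_add,
          map_sum, map_sum]
        rfl
      obtain ⟨h1, h2⟩ := hJ _ _ _ _ hmem
      exact fun i => ⟨h1 i, h2 i⟩)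
  -- `φ` need not be invariant under the involution; composing with `M + Mᴴ` makes the form
  -- symmetric and only doubles the value at self-adjoint `M`.
  let T : Matrix (Fin ℓ) (Fin ℓ) (NCPoly g) →ₗ[ℝ] Matrix (Fin ℓ) (Fin ℓ) (NCPoly g) :=
    { toFun := fun M => M + Mᴴ
      map_add' := fun M N => by rw [Matrix.conjTranspose_add]; abel
      map_smul' := fun r M => by
        rw [Matrix.conjTranspose_smul, star_trivial, RingHom.id_apply, smul_add] }
  let F := (rowSquare g ℓ).compr₂ (φ ∘ₗ S.mkQ ∘ₗ T)
  have hF : ∀ a b, F a b = φ (S.mkQ (rowSquare g ℓ a b)) + φ (S.mkQ (rowSquare g ℓ b a)) := by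
    intro a b
    rw [← rowSquare_conjTranspose a b, ← map_add, ← map_add]
    rfl
  have hsymm : ∀ a b, F a b = F b a := fun a b => by rw [hF, hF, add_comm]
  have hpencil : ∀ q : Fin ν → E₁, ∑ i, ∑ j, F (τ q i) (L i j • τ q j) = 2 * φ (B₂ q q) := by
    intro q
    have hT : T (pencilSquare ℓ L (τ q) (τ q)) = (2 : ℝ) • pencilSquare ℓ L (τ q) (τ q) := by
      have : (pencilSquare ℓ L (τ q) (τ q))ᴴ = pencilSquare ℓ L (τ q) (τ q) := by
        rw [pencilSquare_apply, Matrix.conjTranspose_mul, Matrix.conjTranspose_mul,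
          Matrix.conjTranspose_conjTranspose, hL, Matrix.mul_assoc]
      rw [two_smul]
      exact congrArg (pencilSquare ℓ L (τ q) (τ q) + ·) this
    have h : (φ ∘ₗ S.mkQ ∘ₗ T) (pencilSquare ℓ L (τ q) (τ q)) = 2 * φ (B₂ q q) := by
      rw [LinearMap.comp_apply, LinearMap.comp_apply, hT, map_smul, map_smul, hB₂, smul_eq_mul]
    rw [← h, pencilSquare_eq_sum, map_sum]
    refine Finset.sum_congr rfl fun i _ => ?_
    rw [map_sum]
    rfl
  refine ⟨F, hsymm, fun f a b => ?_, fun a b hb => ?_, fun c hc hcJ => ?_, fun q hq => ?_⟩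
  · simp only [F, LinearMap.compr₂_apply, rowSquare_smul_left]
  · have h1 : S.mkQ (rowSquare g ℓ a b) = 0 := by
      rw [Submodule.mkQ_apply, Submodule.Quotient.mk_eq_zero]
      exact rowsIn_subset_symmSubmodule (vecMulVec_mem_rowsIn _ hb)
    have h2 : S.mkQ (rowSquare g ℓ b a) = 0 := by
      rw [Submodule.mkQ_apply, Submodule.Quotient.mk_eq_zero, ← rowSquare_conjTranspose]
      exact conjTranspose_mem_symmSubmodule (vecMulVec_mem_rowsIn _ hb)
    rw [hF, h1, h2, map_zero, add_zero]
  · have := hφ₁ ⟨c, hc⟩ hcJ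
    rw [hF]
    exact add_pos this this
  · have h := hpencil fun i => ⟨q i, hq i⟩
    change ∑ i, ∑ j, F (q i) (L i j • q j) = _ at h
    rw [h]
    by_cases hN : (fun i => ⟨q i, hq i⟩ : Fin ν → E₁) ∈ N₂
    · have h0 : φ (B₂ (fun i => ⟨q i, hq i⟩) fun i => ⟨q i, hq i⟩) = 0 := by
        have : B₂ (fun i => ⟨q i, hq i⟩) (fun i => ⟨q i, hq i⟩) = 0 := by
          rw [hB₂, Submodule.mkQ_apply, Submodule.Quotient.mk_eq_zero, pencilSquare_apply,
            Matrix.mul_assoc]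
          exact rowsIn_subset_symmSubmodule (mul_mem_rowsIn _ hN)
        rw [this, map_zero]
      rw [h0, mul_zero]
      exact ⟨le_rfl, fun _ => hN⟩
    · have := hφ₂ _ hN
      exact ⟨by positivity, fun h0 => absurd h0 (by positivity)⟩

/-! ### The truncated GNS construction -/

/-- The Gelfand–Naimark–Segal construction, truncated at degree `D`. -/
theorem exists_gns_representation {J : Submodule (NCPoly g) (Row g ℓ)}
    (F : Row g ℓ →ₗ[ℝ] Row g ℓ →ₗ[ℝ] ℝ) (hsymm : ∀ a b, F a b = F b a)
    (hstar : ∀ (f : NCPoly g) a b, F (f • a) b = F a (star f • b))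
    (hker : ∀ a, ∀ b ∈ J, F a b = 0)
    (hpos : ∀ c ∈ rowDegLE g ℓ D, c ∉ J → 0 < F c c) :
    ∃ (n : ℕ) (X : Fin g → Matrix (Fin n) (Fin n) ℝ) (v : Fin ℓ × Fin n → ℝ),
      (∀ r ∈ rowDegLE g ℓ D, evalRow X r *ᵥ v = 0 ↔ r ∈ J) ∧
      ∀ L : Matrix (Fin ν) (Fin ν) (NCPoly g), (∀ i j, L i j ∈ degLE g 1) →
        ∀ h : Fin ν × Fin n → ℝ, ∃ q : Matrix (Fin ν) (Fin ℓ) (NCPoly g),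
          (∀ i, q i ∈ rowDegLE g ℓ D) ∧ (q ∈ rowsIn ν J → h = 0) ∧
          h ⬝ᵥ evalMatrix X L *ᵥ h = ∑ i, ∑ j, F (q i) (L i j • q j) := by
  let E := rowDegLE g ℓ D
  obtain ⟨C, hC⟩ := ((J.restrictScalars ℝ).comap E.subtype).exists_isCompl
  let κ : C →ₗ[ℝ] Row g ℓ := E.subtype ∘ₗ C.subtype
  have hκE : ∀ c, κ c ∈ E := fun c => (c : E).2
  have hκJ : ∀ c, κ c ∈ J → c = 0 := fun c hc =>
    Subtype.ext (Submodule.disjoint_def.1 hC.disjoint _ hc c.2)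
  let FC : C →ₗ[ℝ] C →ₗ[ℝ] ℝ := F.compl₁₂ κ κ
  obtain ⟨n, b, hb⟩ := exists_orthonormal_basis_of_form FC
    (fun a c => hsymm (κ a) (κ c)) (fun a ha => hpos (κ a) (hκE a) fun h => ha (hκJ a h))
  let e : Fin n → Row g ℓ := fun k => κ (b k)
  have he : ∀ k m, F (e k) (e m) = if k = m then 1 else 0 := hb
  -- Coordinates against the orthonormal basis determine a row of degree at most `D` modulo `J`.
  have hdecomp : ∀ r ∈ E, ∃ s ∈ J, r = ∑ k, F (e k) r • e k + s := by
    intro r hr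
    obtain ⟨s, hs, c, hc, hsc⟩ := Submodule.mem_sup.1
      (hC.sup_eq_top ▸ Submodule.mem_top : (⟨r, hr⟩ : E) ∈ _ ⊔ C)
    have hr' : r = s + κ ⟨c, hc⟩ := (congrArg Subtype.val hsc).symm
    have hs' : (s : Row g ℓ) ∈ J := hs
    have hc' : κ ⟨c, hc⟩ = ∑ k, b.repr ⟨c, hc⟩ k • e k := by
      conv_lhs => rw [← b.sum_repr ⟨c, hc⟩, map_sum]
      exact Finset.sum_congr rfl fun k _ => map_smul _ _ _
    refine ⟨s, hs', ?_⟩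
    have hcoef : ∀ k, F (e k) r = b.repr ⟨c, hc⟩ k := by
      intro k
      rw [hr', map_add, hker _ _ hs', zero_add, hc']
      simp [he]
    simp only [hcoef]
    rw [← hc', hr', add_comm]
  let X : Fin g → Matrix (Fin n) (Fin n) ℝ :=
    fun i => Matrix.of fun k m => F (e k) (letter (Sum.inl i) • e m)
  have hletter : ∀ a k m, eval X (letter a) k m = F (e k) (letter a • e m) := by
    rintro (i | i) k m
    · rw [eval_letter]
      rfl
    · rw [eval_letter]
      -- The transpose represents `xᵢ*` because `F` is symmetric and satisfies `hstar`.
      change F (e m) (letter (Sum.inl i) • e k) = _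
      rw [hsymm, hstar, star_letter]
      rfl
  -- Degree one is essential: a product of compressions is in general not the compression of the
  -- product.
  have hlinear : ∀ f ∈ degLE g 1, ∀ k m, eval X f k m = F (e k) (f • e m) := by
    intro f hf k m
    induction hf using Submodule.span_induction with
    | mem f hf =>
      obtain ⟨w, hw, rfl⟩ := hf
      match w, hw with
      | [], _ => simp [word_nil, Matrix.one_apply, he]
      | [a], _ => simp [word_cons, word_nil, hletter]
      | _ :: _ :: _, hw => simp at hw
    | zero => simp
    | add f f' _ _ hf hf' => simp [add_smul, hf, hf']
    | smul r f _ hf => simp [hf]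
  let coord : Row g ℓ → Fin n → ℝ := fun r k => F (e k) r
  -- The product `letter a • r` may leave `E`, but `F` is defined on all rows. Only the component of
  -- `r` in `J` is lost, and `J` is stable under left multiplication.
  have hact : ∀ a, ∀ r ∈ E, eval X (letter a) *ᵥ coord r = coord (letter a • r) := by
    intro a r hr
    obtain ⟨s, hs, hrs⟩ := hdecomp r hr
    ext k
    have h1 : F (e k) (letter a • r) = ∑ m, F (e m) r * F (e k) (letter a • e m) := by
      conv_lhs => rw [hrs]
      rw [smul_add, map_add, hker _ _ (J.smul_mem _ hs), add_zero, Finset.smul_sum, map_sum]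
      refine Finset.sum_congr rfl fun m _ => ?_
      rw [smul_comm, map_smul, smul_eq_mul]
    change ∑ m, eval X (letter a) k m * F (e m) r = F (e k) (letter a • r)
    rw [h1]
    exact Finset.sum_congr rfl fun m _ => by rw [hletter, mul_comm]
  let ε : Fin ℓ → Row g ℓ := fun j => Pi.single j 1
  have hwordE : ∀ (j : Fin ℓ) (f : NCPoly g), f ∈ degLE g D → f • ε j ∈ E := by
    intro j f hf
    refine mem_rowDegLE.2 fun i => ?_
    by_cases hij : i = j
    · subst hij
      simpa [ε] using hf
    · simp [ε, hij]
  have hword : ∀ (j : Fin ℓ) (w : List (Letter g)), w.length ≤ D →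
      eval X (word w) *ᵥ coord (ε j) = coord (word w • ε j) := by
    intro j w
    induction w with
    | nil => intro _; simp [word_nil]
    | cons a w ih =>
      intro hw
      have hw' : w.length ≤ D := (Nat.le_succ _).trans hw
      rw [word_cons, map_mul, ← Matrix.mulVec_mulVec, ih hw',
        hact _ _ (hwordE j _ (word_mem_degLE hw')), smul_smul]
  have hpoly : ∀ (j : Fin ℓ), ∀ f ∈ degLE g D,
      eval X f *ᵥ coord (ε j) = coord (f • ε j) := by
    intro j f hf
    induction hf using Submodule.span_induction with
    | mem f hf =>
      obtain ⟨w, hw, rfl⟩ := hf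
      exact hword j w hw
    | zero => ext k; simp [coord]
    | add f f' _ _ hf hf' =>
      rw [map_add, Matrix.add_mulVec, hf, hf']
      ext k; simp [coord, add_smul]
    | smul r f _ hf =>
      rw [map_smul, Matrix.smul_mulVec, hf]
      ext k; simp [coord]
  let v : Fin ℓ × Fin n → ℝ := fun jk => coord (ε jk.1) jk.2
  have hrow : ∀ r ∈ E, evalRow X r *ᵥ v = coord r := by
    intro r hr
    have hsum : r = ∑ j, r j • ε j := by
      ext i
      simp [ε, Finset.sum_apply, Pi.single_apply]
    rw [evalRow_mulVec]
    conv_rhs => rw [hsum]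
    ext k
    rw [Finset.sum_apply]
    change _ = F (e k) _
    rw [map_sum]
    exact Finset.sum_congr rfl fun j _ => congrFun (hpoly j (r j) (mem_rowDegLE.1 hr j)) k
  refine ⟨n, X, v, fun r hr => ?_, fun L hL h => ?_⟩
  · rw [hrow r hr]
    constructor
    · intro h0
      obtain ⟨s, hs, hrs⟩ := hdecomp r hr
      have : ∀ k, F (e k) r = 0 := fun k => congrFun h0 k
      rw [hrs]
      simpa [this] using hs
    · intro hrJ
      ext k
      exact hker _ _ hrJ
  -- Each block of `h` is read as the coordinates of a row in the complement of `J`.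
  · refine ⟨fun i => ∑ k, h (i, k) • e k,
      fun i => E.sum_mem fun k _ => E.smul_mem _ (hκE _), fun hq => ?_, ?_⟩
    · ext ⟨i, k⟩
      have h1 : F (e k) (∑ m, h (i, m) • e m) = 0 := hker _ _ (hq i)
      simpa [he] using h1
    · rw [dotProduct, Fintype.sum_prod_type]
      refine Finset.sum_congr rfl fun i _ => ?_
      simp only [evalMatrix_mulVec, Finset.mul_sum]
      rw [Finset.sum_comm]
      refine Finset.sum_congr rfl fun j _ => ?_
      simp only [Finset.smul_sum, map_sum, LinearMap.sum_apply, map_smul, LinearMap.smul_apply,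
        smul_eq_mul, Matrix.mulVec, dotProduct, Finset.mul_sum, smul_comm (L i j) (h _)]
      rw [Finset.sum_comm]
      refine Finset.sum_congr rfl fun m _ => Finset.sum_congr rfl fun k _ => ?_
      rw [hlinear _ (hL i j)]
      ring

/-! ### Separating points -/

/-- An `L`-real left module is, in bounded degree, the annihilator of a point at which `L` is
positive semidefinite, and even positive definite if the module is strongly `L`-real. -/
theorem IsLReal.exists_point {L : Matrix (Fin ν) (Fin ν) (NCPoly g)} (hL : IsLinearPencil L)
    {J : Submodule (NCPoly g) (Row g ℓ)} (hJ : IsLReal L J) (D : ℕ) :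
    ∃ (n : ℕ) (X : Fin g → Matrix (Fin n) (Fin n) ℝ) (v : Fin ℓ × Fin n → ℝ),
      (∀ r ∈ rowDegLE g ℓ D, evalRow X r *ᵥ v = 0 ↔ r ∈ J) ∧
      (evalMatrix X L).PosSemidef ∧ (IsStronglyLReal L J → (evalMatrix X L).PosDef) := by
  obtain ⟨F, hsymm, hstar, hker, hpos, hsq⟩ := hJ.exists_form hL.symm D
  obtain ⟨n, X, v, hXv, hXL⟩ := exists_gns_representation (ν := ν) F hsymm hstar hker hpos
  have hherm := isHermitian_evalMatrix X hL.symm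
  refine ⟨n, X, v, hXv, .of_dotProduct_mulVec_nonneg hherm fun h => ?_,
    fun hS => .of_dotProduct_mulVec_pos hherm fun h hne => ?_⟩
  · obtain ⟨q, hq, -, heq⟩ := hXL L hL.deg_le h
    rw [star_trivial, heq]
    exact (hsq q hq).1
  · obtain ⟨q, hq, hq0, heq⟩ := hXL L hL.deg_le h
    rw [star_trivial, heq]
    refine (hsq q hq).1.lt_of_ne fun h0 => hne (hq0 ?_)
    have hLq := (hsq q hq).2 h0.symm
    -- Since `L * q` has rows in `J`, so does `q* L q`; strong reality, applied to this single term,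
    -- then puts `q` itself in `J`.
    refine (hS 0 1 Fin.elim0 (fun _ => q) ?_).2 0
    simp only [weightedSOS, Finset.univ_eq_empty, Finset.sum_empty, zero_add,
      Finset.sum_const, Finset.card_univ, Fintype.card_fin, one_smul, Matrix.mul_assoc]
    exact rowsIn_subset_symmSubmodule (mul_mem_rowsIn _ hLq)

theorem IsStronglyLReal.isLReal {L : Matrix (Fin ν) (Fin ν) (NCPoly g)}
    {J : Submodule (NCPoly g) (Row g ℓ)} (hJ : IsStronglyLReal L J) : IsLReal L J :=
  fun r s p q h => ⟨(hJ r s p q h).1, fun j => mul_mem_rowsIn L ((hJ r s p q h).2 j)⟩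

theorem mem_zeroSet_iff (X : Fin g → Matrix (Fin n) (Fin n) ℝ) (v : Fin ℓ × Fin n → ℝ)
    (I : Submodule (NCPoly g) (Row g ℓ)) :
    (X, v) ∈ zeroSet (I : Set (Row g ℓ)) n ↔ I ≤ annihilator X v := Iff.rfl

/-- A finitely generated submodule of an `L`-real left module and an outside element are
separated by a point at which `L` is positive semidefinite. -/
theorem IsLReal.exists_point_separating {L : Matrix (Fin ν) (Fin ν) (NCPoly g)}
    (hL : IsLinearPencil L) {I J : Submodule (NCPoly g) (Row g ℓ)} (hI : I.FG) (hIJ : I ≤ J)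
    (hJ : IsLReal L J) {p : Row g ℓ} (hp : p ∉ J) :
    ∃ (n : ℕ) (X : Fin g → Matrix (Fin n) (Fin n) ℝ) (v : Fin ℓ × Fin n → ℝ),
      (X, v) ∈ zeroSet (I : Set (Row g ℓ)) n ∧ evalRow X p *ᵥ v ≠ 0 ∧
      (evalMatrix X L).PosSemidef ∧ (IsStronglyLReal L J → (evalMatrix X L).PosDef) := by
  obtain ⟨G, rfl⟩ := hI
  choose deg hdeg using exists_mem_rowDegLE (g := g) (ℓ := ℓ)
  -- The degree bound covers `p` and every generator; vanishing at the generators gives vanishing on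
  -- all of `I`.
  obtain ⟨n, X, v, hXv, hpsd, hpd⟩ := hJ.exists_point hL (max (deg p) (G.sup deg))
  refine ⟨n, X, v, ?_, ?_, hpsd, hpd⟩
  · rw [mem_zeroSet_iff, Submodule.span_le]
    intro r hr
    refine (hXv r (rowDegLE_mono ?_ (hdeg r))).2 (hIJ (Submodule.subset_span hr))
    exact (Finset.le_sup hr).trans (le_max_right _ _)
  · rw [Ne, hXv p (rowDegLE_mono (le_max_left _ _) (hdeg p))]
    exact hp

end NCReal

theorem corollary4 {g ν ℓ : ℕ} (L : Matrix (Fin ν) (Fin ν) (NCReal.NCPoly g))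
    (hL : NCReal.IsLinearPencil L)
    (I : Submodule (NCReal.NCPoly g) (NCReal.Row g ℓ)) (hI : I.FG)
    (p : NCReal.Row g ℓ) :
    ((∀ (n : ℕ) (X : Fin g → Matrix (Fin n) (Fin n) ℝ) (v : Fin ℓ × Fin n → ℝ),
        (X, v) ∈ NCReal.zeroSet (I : Set (NCReal.Row g ℓ)) n →
        (NCReal.evalMatrix X L).PosSemidef →
        (NCReal.evalRow X p).mulVec v = 0) ↔ p ∈ NCReal.lRadical L I) ∧
    ((∀ (n : ℕ) (X : Fin g → Matrix (Fin n) (Fin n) ℝ) (v : Fin ℓ × Fin n → ℝ),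
        (X, v) ∈ NCReal.zeroSet (I : Set (NCReal.Row g ℓ)) n →
        (NCReal.evalMatrix X L).PosDef →
        (NCReal.evalRow X p).mulVec v = 0) ↔ p ∈ NCReal.strongLRadical L I) := by
  refine ⟨⟨fun h => ?_, fun hp n X v hXv hX => ?_⟩, ⟨fun h => ?_, fun hp n X v hXv hX => ?_⟩⟩
  · refine Submodule.mem_sInf.2 fun J ⟨hIJ, hJ⟩ => ?_
    by_contra hp
    obtain ⟨n, X, v, hXv, hne, hpsd, -⟩ := hJ.exists_point_separating hL hI hIJ hp
    exact hne (h n X v hXv hpsd)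
  -- The annihilator of the point is one of the modules being intersected.
  · exact Submodule.mem_sInf.1 hp _ ⟨hXv, NCReal.isLReal_annihilator X hX v⟩
  · refine Submodule.mem_sInf.2 fun J ⟨hIJ, hJ⟩ => ?_
    by_contra hp
    obtain ⟨n, X, v, hXv, hne, -, hpd⟩ := hJ.isLReal.exists_point_separating hL hI hIJ hp
    exact hne (h n X v hXv (hpd hJ))
  · exact Submodule.mem_sInf.1 hp _ ⟨hXv, NCReal.isStronglyLReal_annihilator X hX v⟩
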